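/- Let $K$ be a field with algebraic closure $\overline K$, let $R = K[x_1,\dots,x_n]$, and let $f_1,\dots,f_c \in R$ with $c \le n$. For an ideal $I\subseteq R$ let $V(I)\subseteq \overline K^n$ denote the set of common zeros of $I$; the sets $V(I)$ are the closed sets of the ($K$-)Zariski topology of $\overline K^n$. The codimension of an irreducible closed set $Z$ is the supremum of the lengths $d$ of chains $Z = Z_0 \subsetneq Z_1 \subsetneq \dots \subsetneq Z_d$ of irreducible closed subsets of $\overline K^n$. The nondegenerate locus of $f_1,\dots,f_c$ is the union of the irreducible components of $V(\langle f_1,\dots,f_c\rangle)$ that have codimension exactly $c$. For ideals $I, J\subseteq R$ write $I : J = \{p \in R \mid pJ \subseteq I\}$ and $I : J^\infty = \bigcup_{m\ge 0} (I : J^m)$, and write $I : f^\infty$ for $I : \langle f\rangle^\infty$. Consider the following algorithm, in which ideal quotients and saturations are primitive operations. Start with the ideal $J = \langle 0\rangle$ and the empty set $\mathcal K = \varnothing$ of ideals. For $k = 1,\dots,c$ in turn: put $H \leftarrow J : f_k^\infty$; then $\mathcal K \leftarrow \mathcal K \cup \{J : H\}$; then $J \leftarrow H + \langle f_k\rangle$;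 then, for each $K' \in \mathcal K$, one after the other and in any order, $J \leftarrow J : K'^\infty$. Finally return $J$. Theorem. On input $f_1,\dots,f_c$ the algorithm terminates and outputs an ideal $J$, and, whatever the order in which the elements of $\mathcal K$ are visited, the output $J$ satisfies that $V(J)$ is the nondegenerate locus of $f_1,\dots,f_c$. -/

import Mathlib

noncomputable section

namespace NondegenerateLocus

/-- The affine space `Lⁿ`, to be equipped with the Zariski topology of algebraic sets that are
defined over the subfield `K`. -/
def AffineSpace (K L : Type*) (n : ℕ) [Field K] [Field L] [Algebra K L] : Type _ :=
  Fin n → L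

section Geometry

variable {K : Type*} (L : Type*) {n : ℕ} [Field K] [Field L] [Algebra K L]

/-- `V(I)`: the common zeros in `Lⁿ` of the polynomials in `I`, which have coefficients in `K`. -/
def zeros (I : Ideal (MvPolynomial (Fin n) K)) : Set (AffineSpace K L n) :=
  MvPolynomial.zeroLocus L I

theorem zeros_inf (I J : Ideal (MvPolynomial (Fin n) K)) :
    zeros L (I ⊓ J) = zeros L I ∪ zeros L J := by
  apply Set.Subset.antisymm
  · intro x hx
    by_contra h
    have h1 : ¬ ∀ p ∈ I, MvPolynomial.aeval x p = 0 := fun h' => h (Or.inl h')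
    have h2 : ¬ ∀ p ∈ J, MvPolynomial.aeval x p = 0 := fun h' => h (Or.inr h')
    push Not at h1 h2
    obtain ⟨p, hp, hp0⟩ := h1
    obtain ⟨q, hq, hq0⟩ := h2
    have := hx (p * q) ⟨I.mul_mem_right q hp, J.mul_mem_left p hq⟩
    rw [map_mul] at this
    exact (mul_ne_zero hp0 hq0) this
  · rintro x (hx | hx) p hp
    · exact hx p hp.1
    · exact hx p hp.2

theorem zeros_sSup (A : Set (Ideal (MvPolynomial (Fin n) K))) :
    zeros L (sSup A) = ⋂₀ (zeros L '' A) := by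
  apply Set.Subset.antisymm
  · rintro x hx _ ⟨I, hI, rfl⟩ p hp
    exact hx p (le_sSup hI hp)
  · intro x hx
    have h : sSup A ≤ RingHom.ker (MvPolynomial.aeval (R := K) (x : Fin n → L)) :=
      sSup_le fun I hI p hp => hx (zeros L I) ⟨I, hI, rfl⟩ p hp
    exact fun p hp => h hp

/-- The Zariski topology over `K` on `Lⁿ`: the closed sets are the zero sets `V(I)` of the ideals
`I` of `K[x₁, …, xₙ]`. -/
instance : TopologicalSpace (AffineSpace K L n) :=
  TopologicalSpace.ofClosed (Set.range (zeros (K := K) L))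
    ⟨⊤, MvPolynomial.zeroLocus_top⟩
    (fun A hA => by
      refine ⟨sSup (zeros L ⁻¹' A), ?_⟩
      rw [zeros_sSup, Set.image_preimage_eq_of_subset hA])
    (by
      rintro _ ⟨I, rfl⟩ _ ⟨J, rfl⟩
      exact ⟨I ⊓ J, zeros_inf L I J⟩)

variable {L}

/-- `Z` is an irreducible component of `V`: a maximal irreducible closed set contained in `V`. -/
def IsComponent (V : Set (AffineSpace K L n))
    (Z : TopologicalSpace.IrreducibleCloseds (AffineSpace K L n)) : Prop :=
  Maximal (fun W : TopologicalSpace.IrreducibleCloseds (AffineSpace K L n) =>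
    (W : Set (AffineSpace K L n)) ⊆ V) Z

/-- The codimension of an irreducible closed set `Z` of `Lⁿ`: the supremum of the lengths `d` of
the chains `Z = Z₀ ⊊ Z₁ ⊊ ⋯ ⊊ Z_d` of irreducible closed sets. -/
def codim (Z : TopologicalSpace.IrreducibleCloseds (AffineSpace K L n)) : ℕ∞ :=
  Order.coheight Z

variable (L)

/-- The nondegenerate locus of `f₁, …, f_c`: the union of the irreducible components of
`V(f₁, …, f_c)` that have codimension exactly `c`. -/
def nondegenerateLocus {c : ℕ} (f : Fin c → MvPolynomial (Fin n) K) :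
    Set (AffineSpace K L n) :=
  ⋃ Z ∈ {Z : TopologicalSpace.IrreducibleCloseds (AffineSpace K L n) |
      IsComponent (zeros L (Ideal.span (Set.range f))) Z ∧ codim Z = (c : ℕ∞)},
    (Z : Set (AffineSpace K L n))

end Geometry

section Algorithm

variable {R : Type*} [CommRing R]

/-- The quotient ideal `I : J = {p | p J ⊆ I}`. -/
def quot (I J : Ideal R) : Ideal R :=
  Submodule.colon I (J : Set R)

/-- The saturation `I : J^∞`, the union of the increasing sequence `I : J^m`. -/
def sat (I J : Ideal R) : Ideal R :=
  ⨆ m : ℕ, quot I (J ^ m)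

theorem exists_sat_eq [IsNoetherianRing R] (I J : Ideal R) :
    ∃ N : ℕ, ∀ m, N ≤ m → sat I J = quot I (J ^ m) := by
  have hmono : Monotone fun m : ℕ => quot I (J ^ m) := fun _ _ h =>
    Submodule.colon_mono le_rfl (Ideal.pow_le_pow_right h)
  obtain ⟨N, hN⟩ := monotone_stabilizes_iff_noetherian.mpr ‹IsNoetherian R R›
    ⟨fun m : ℕ => quot I (J ^ m), hmono⟩
  refine ⟨N, fun m hm => le_antisymm (iSup_le fun j => ?_) (le_iSup (fun j => quot I (J ^ j)) m)⟩
  have h1 : quot I (J ^ N) = quot I (J ^ m) := hN m hm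
  have h2 : quot I (J ^ N) = quot I (J ^ max m j) := hN _ (hm.trans (le_max_left _ _))
  rw [← h1, h2]
  exact hmono (le_max_right m j)

/-- The states of the algorithm. -/
inductive State (R : Type*) [CommRing R] : Type _
  /-- The head of the outer loop, after `k` completed iterations. -/
  | outer (k : ℕ) (J : Ideal R) (𝒦 : Finset (Ideal R)) : State R
  /-- The inner (cleaning) loop of the iteration with index `k`; `rest` holds the elements of `𝒦`
  that this loop has not visited yet. -/
  | inner (k : ℕ) (J : Ideal R) (𝒦 rest : Finset (Ideal R)) : State R
  /-- The algorithm has returned `J`. -/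
  | returned (J : Ideal R) : State R

/-- The ideal `J` and the empty set `𝒦` with which the algorithm starts. -/
def State.start (R : Type*) [CommRing R] : State R :=
  State.outer 0 ⊥ ∅

open Classical in
/-- One step of the algorithm on input `f₁, …, f_c` (indexed from `0`), quotients and saturations
of ideals being primitive operations. The inner loop visits the elements of `𝒦` in any order. -/
inductive Step {c : ℕ} (f : Fin c → R) : State R → State R → Prop
  /-- `H ← J : f_k^∞`, then `𝒦 ← 𝒦 ∪ {J : H}`, then `J ← H + ⟨f_k⟩`, and the inner loop starts. -/
  | body (k : ℕ) (hk : k < c) (J H : Ideal R) (𝒦 𝒦' : Finset (Ideal R))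
      (hH : H = sat J (Ideal.span {f ⟨k, hk⟩})) (h𝒦 : 𝒦' = 𝒦 ∪ {quot J H}) :
      Step f (State.outer k J 𝒦) (State.inner k (H ⊔ Ideal.span {f ⟨k, hk⟩}) 𝒦' 𝒦')
  /-- `J ← J : K^∞` for a not yet visited element `K` of `𝒦`. -/
  | clean (k : ℕ) (J K : Ideal R) (𝒦 rest : Finset (Ideal R)) (hK : K ∈ rest) :
      Step f (State.inner k J 𝒦 rest) (State.inner k (sat J K) 𝒦 (rest.erase K))
  /-- The inner loop ends. -/
  | next (k : ℕ) (J : Ideal R) (𝒦 : Finset (Ideal R)) :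
      Step f (State.inner k J 𝒦 ∅) (State.outer (k + 1) J 𝒦)
  /-- The outer loop ends after `c` iterations, and `J` is returned. -/
  | ret (J : Ideal R) (𝒦 : Finset (Ideal R)) :
      Step f (State.outer c J 𝒦) (State.returned J)

/-- `s` occurs in some run of the algorithm on input `f`. -/
def Reachable {c : ℕ} (f : Fin c → R) (s : State R) : Prop :=
  Relation.ReflTransGen (Step f) (State.start R) s

/-- The algorithm terminates on input `f`: there is no infinite run, and a run can only stop by
returning an ideal. -/
def Terminates {c : ℕ} (f : Fin c → R) : Prop :=
  (¬ ∃ s : ℕ → State R, s 0 = State.start R ∧ ∀ i, Step f (s i) (s (i + 1))) ∧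
    ∀ s, Reachable f s → (∃ t, Step f s t) ∨ ∃ J, s = State.returned J

/-- Some run of the algorithm on input `f` returns `J`. -/
def Outputs {c : ℕ} (f : Fin c → R) (J : Ideal R) : Prop :=
  Reachable f (State.returned J)

end Algorithm

end NondegenerateLocus

end

/-! By the Nullstellensatz, irreducible closed sets correspond to primes of `K[x₁, …, xₙ]` with
inclusions reversed, so codimension is height. It remains to see that the minimal primes of the
output are exactly the minimal primes of `⟨f₁, …, f_c⟩` of height `c`; call these nondegenerate.

After `k` rounds the following holds (`Invariant`). At a nondegenerate `p`, the localization of `J`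
is generated by `f₁, …, f_k`, and no recorded ideal lies in `p`. Every prime over `f₁, …, f_k`
contains `J` or a recorded ideal. Minimal primes of `J` have height at least `k` and contain no
recorded ideal already cleaned away. When `k = c`, a prime over the `fᵢ` inside a minimal prime `p`
of `J` contains no recorded ideal, hence contains `J` and equals `p`; so `p` is minimal over the
`fᵢ`, and Krull's theorem bounds its height by `c`. Conversely, `J` lies in each nondegenerate prime
by the local description. Each cleaning step preserves the invariant, so their order is irrelevant.

The algebraic input is that at a nondegenerate `p` the `fᵢ` are a system of parameters of the
regular local ring `R_p`, hence a regular sequence. Thus saturating by `f_k` changes nothing locally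
at `p`. This rests on two facts: regular local rings are Cohen–Macaulay, and systems of parameters
in Cohen–Macaulay modules are regular sequences. -/

/-! ### Depth, associated primes and systems of parameters -/

section RegularSequences

open IsLocalRing RingTheory.Sequence Pointwise

theorem IsSMulRegular.notMem_of_isAssociatedPrime {R M : Type*} [CommRing R] [IsNoetherianRing R]
    [AddCommGroup M] [Module R M] {x : R} (hx : IsSMulRegular M x) {q : Ideal R}
    (hq : IsAssociatedPrime q M) : x ∉ q := by
  intro h
  have : x ∈ ⋃ p ∈ associatedPrimes R M, (p : Set R) := Set.mem_iUnion₂_of_mem hq h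
  rw [biUnion_associatedPrimes_eq_compl_regular] at this
  exact this hx

theorem isSMulRegular_of_forall_notMem_associatedPrime {R M : Type*} [CommRing R]
    [IsNoetherianRing R] [AddCommGroup M] [Module R M] {x : R}
    (h : ∀ q, IsAssociatedPrime q M → x ∉ q) : IsSMulRegular M x := by
  by_contra hx
  have : x ∈ ⋃ p ∈ associatedPrimes R M, (p : Set R) := by
    rw [biUnion_associatedPrimes_eq_compl_regular]
    exact hx
  obtain ⟨q, hq, hxq⟩ := Set.mem_iUnion₂.1 this
  exact h q hq hxq

variable {A : Type*} [CommRing A] [IsLocalRing A] [IsNoetherianRing A]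

/-- An associated prime of `M` together with an `M`-regular element `x` lie in an associated prime
of `M / xM`. -/
theorem exists_isAssociatedPrime_quotSMulTop {M : Type*} [AddCommGroup M] [Module A M]
    [Module.Finite A M] {x : A} (hxm : x ∈ maximalIdeal A) (hx : IsSMulRegular M x)
    {q : Ideal A} (hq : IsAssociatedPrime q M) :
    ∃ q', IsAssociatedPrime q' (QuotSMulTop x M) ∧ q ≤ q' ∧ x ∈ q' := by
  obtain ⟨hqp, z, hz⟩ := isAssociatedPrime_iff.1 hq
  let N : Submodule A M :=
    { carrier := {w | ∀ a ∈ q, a • w = 0}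
      add_mem' := fun {u v} hu hv a ha => by rw [smul_add, hu a ha, hv a ha, add_zero]
      zero_mem' := fun a _ => smul_zero a
      smul_mem' := fun b w hw a ha => by rw [smul_comm, hw a ha, smul_zero] }
  have hzN : z ∈ N := by
    intro a ha
    rw [hz, Submodule.mem_colon_singleton] at ha
    exact ha
  have hz0 : z ≠ 0 := by
    rintro rfl
    exact hqp.ne_top (by rw [hz]; ext; simp)
  -- `N` is the part of `M` killed by `q`. As `x` is regular, `N ≤ xM` would give `N ≤ xN`, and
  -- Nakayama would force `N = 0`.
  have hN : ¬ N ≤ x • (⊤ : Submodule A M) := by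
    intro hle
    have h1 : N ≤ (Ideal.span {x} : Ideal A) • N := by
      intro w hw
      obtain ⟨v, -, rfl⟩ := (Submodule.mem_smul_pointwise_iff_exists _ _ _).1 (hle hw)
      refine Submodule.smul_mem_smul (Ideal.mem_span_singleton_self x) fun a ha => ?_
      apply hx.right_eq_zero_of_smul
      rw [smul_comm]
      exact hw a ha
    have h2 := Submodule.eq_bot_of_le_smul_of_le_jacobson_bot _ N (IsNoetherian.noetherian N) h1
      (by rw [Ideal.span_le, Set.singleton_subset_iff]
          exact maximalIdeal_le_jacobson _ hxm)
    exact hz0 ((Submodule.mem_bot A).1 (h2 ▸ hzN))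
  obtain ⟨w, hw, hwx⟩ := SetLike.not_le_iff_exists.1 hN
  have hw0 : (Submodule.Quotient.mk w : QuotSMulTop x M) ≠ 0 := by
    rwa [Ne, Submodule.Quotient.mk_eq_zero]
  obtain ⟨q', hq', hle⟩ := exists_le_isAssociatedPrime_of_isNoetherianRing A _ hw0
  refine ⟨q', hq', fun a ha => hle ?_, hle ?_⟩
  · rw [Submodule.mem_colon_singleton, ← Submodule.Quotient.mk_smul, hw a ha]
    simp
  · rw [Submodule.mem_colon_singleton, ← Submodule.Quotient.mk_smul, Submodule.mem_bot,
      Submodule.Quotient.mk_eq_zero]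
    exact Submodule.smul_mem_pointwise_smul _ _ _ trivial

/-- The depth of a module is at most the dimension of each of its associated primes. -/
theorem RingTheory.Sequence.IsRegular.length_le_coheight {M : Type*} [AddCommGroup M] [Module A M]
    [Module.Finite A M] {rs : List A} (hrs : IsRegular M rs) (hm : ∀ r ∈ rs, r ∈ maximalIdeal A)
    {q : Ideal A} (hq : IsAssociatedPrime q M) :
    (rs.length : ℕ∞) ≤ Order.coheight (⟨q, hq.isPrime⟩ : PrimeSpectrum A) := by
  induction rs generalizing M q with
  | nil => simp
  | cons x rs ih =>
    rw [isRegular_cons_iff] at hrs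
    have hxm := hm x (by simp)
    obtain ⟨q', hq', hle, hxq'⟩ := exists_isAssociatedPrime_quotSMulTop hxm hrs.1 hq
    have h1 := ih hrs.2 (fun r hr => hm r (by simp [hr])) hq'
    have hlt : (⟨q, hq.isPrime⟩ : PrimeSpectrum A) < ⟨q', hq'.isPrime⟩ :=
      lt_of_le_of_ne hle fun h =>
        hrs.1.notMem_of_isAssociatedPrime hq (by rwa [show q = q' from congrArg (·.asIdeal) h])
    refine le_trans ?_ (Order.coheight_add_one_le hlt)
    rw [List.length_cons, Nat.cast_add, Nat.cast_one]
    gcongr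

/-- If `a` and `x` are `M`-regular and the maximal ideal is associated to `M / xM`, then it is
associated to `M / aM`. -/
theorem isAssociatedPrime_maximalIdeal_quotSMulTop {M : Type*} [AddCommGroup M] [Module A M]
    {a x : A} (ham : a ∈ maximalIdeal A) (ha : IsSMulRegular M a) (hx : IsSMulRegular M x)
    (h : IsAssociatedPrime (maximalIdeal A) (QuotSMulTop x M)) :
    IsAssociatedPrime (maximalIdeal A) (QuotSMulTop a M) := by
  obtain ⟨hp, z, hz⟩ := isAssociatedPrime_iff.1 h
  obtain ⟨z, rfl⟩ := Submodule.Quotient.mk_surjective _ z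
  have key : ∀ b, b ∈ maximalIdeal A ↔ b • z ∈ x • (⊤ : Submodule A M) := fun b => by
    rw [hz, Submodule.mem_colon_singleton, ← Submodule.Quotient.mk_smul, Submodule.mem_bot,
      Submodule.Quotient.mk_eq_zero]
  -- The relation `a z = x w` exchanges the two quotients: the class of `w` modulo `aM` plays the
  -- role of the class of `z` modulo `xM`.
  obtain ⟨w, -, hw⟩ := (Submodule.mem_smul_pointwise_iff_exists _ _ _).1 ((key a).1 ham)
  rw [isAssociatedPrime_iff]
  refine ⟨hp, Submodule.Quotient.mk w, ?_⟩
  have hle : maximalIdeal A ≤ Submodule.colon ⊥ {(Submodule.Quotient.mk w : QuotSMulTop a M)} := by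
    intro b hb
    rw [Submodule.mem_colon_singleton, ← Submodule.Quotient.mk_smul, Submodule.mem_bot,
      Submodule.Quotient.mk_eq_zero]
    obtain ⟨v, -, hv⟩ := (Submodule.mem_smul_pointwise_iff_exists _ _ _).1 ((key b).1 hb)
    have : b • w = a • v := by
      apply hx
      change x • b • w = x • a • v
      rw [smul_comm x b, hw, smul_comm x a, hv, smul_comm]
    rw [this]
    exact Submodule.smul_mem_pointwise_smul _ _ _ trivial
  refine (maximalIdeal.isMaximal A).eq_of_le ?_ hle
  intro htop
  have h1 : (1 : A) ∈ Submodule.colon ⊥ {(Submodule.Quotient.mk w : QuotSMulTop a M)} := by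
    rw [htop]; trivial
  rw [Submodule.mem_colon_singleton, one_smul, Submodule.mem_bot,
      Submodule.Quotient.mk_eq_zero] at h1
  obtain ⟨v, -, rfl⟩ := (Submodule.mem_smul_pointwise_iff_exists _ _ _).1 h1
  have : z = x • v := by
    apply ha
    change a • z = a • x • v
    rw [← hw, smul_comm]
  refine (Ideal.ne_top_iff_one _).1 hp.ne_top ((key 1).2 ?_)
  rw [one_smul, this]
  exact Submodule.smul_mem_pointwise_smul _ _ _ trivial

/-- Prime avoidance: an element of the maximal ideal that is regular on two modules of positive
depth. -/
theorem exists_isSMulRegular_of_not_isAssociatedPrime {M N : Type*} [AddCommGroup M] [Module A M]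
    [Module.Finite A M] [AddCommGroup N] [Module A N] [Module.Finite A N]
    (hM : ¬ IsAssociatedPrime (maximalIdeal A) M) (hN : ¬ IsAssociatedPrime (maximalIdeal A) N) :
    ∃ b ∈ maximalIdeal A, IsSMulRegular M b ∧ IsSMulRegular N b := by
  have hfin : (associatedPrimes A M ∪ associatedPrimes A N).Finite :=
    (associatedPrimes.finite A M).union (associatedPrimes.finite A N)
  have hprime : ∀ q ∈ hfin.toFinset, q ≠ ⊤ → q ≠ ⊤ → q.IsPrime := fun q hq _ _ => by
    rw [Set.Finite.mem_toFinset] at hq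
    exact hq.elim (fun h => h.isPrime) fun h => h.isPrime
  -- Prime avoidance allows two non-prime members; none is needed, and `⊤` fills both places.
  have h := (Ideal.subset_union_prime (f := fun q : Ideal A => q) ⊤ ⊤ hprime
    (I := maximalIdeal A)).not.2 (by
      rintro ⟨q, hq, hle⟩
      rw [Set.Finite.mem_toFinset] at hq
      have hq' : q.IsPrime := hq.elim (fun h => h.isPrime) fun h => h.isPrime
      have := (maximalIdeal.isMaximal A).eq_of_le hq'.ne_top hle
      subst this
      exact hq.elim hM hN)
  obtain ⟨b, hb, hb'⟩ := Set.not_subset.1 h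
  have hb'' : ∀ q ∈ associatedPrimes A M ∪ associatedPrimes A N, b ∉ q := fun q hq hbq =>
    hb' (Set.mem_iUnion₂_of_mem (by simpa using hq) hbq)
  exact ⟨b, hb, isSMulRegular_of_forall_notMem_associatedPrime fun q hq => hb'' q (Or.inl hq),
    isSMulRegular_of_forall_notMem_associatedPrime fun q hq => hb'' q (Or.inr hq)⟩

/-- Dividing by a regular element lowers the depth by at most one. -/
theorem exists_isRegular_quotSMulTop {M : Type*} [AddCommGroup M] [Module A M]
    [Module.Finite A M] {a : A} {rs : List A} (hrs : IsRegular M (a :: rs))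
    (hm : ∀ r ∈ a :: rs, r ∈ maximalIdeal A) {x : A} (hxm : x ∈ maximalIdeal A)
    (hx : IsSMulRegular M x) :
    ∃ ss : List A, ss.length = rs.length ∧ (∀ r ∈ ss, r ∈ maximalIdeal A) ∧
      IsRegular (QuotSMulTop x M) ss := by
  generalize hn : rs.length = n
  induction n generalizing M a rs x with
  | zero =>
    have : Nontrivial M := hrs.nontrivial
    have : Nontrivial (QuotSMulTop x M) := nontrivial_quotSMulTop_of_mem_maximalIdeal M hxm
    exact ⟨[], rfl, by simp, IsRegular.nil _ _⟩
  | succ n ih =>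
    obtain _ | ⟨b', rs⟩ := rs
    · simp at hn
    simp only [List.length_cons, Nat.add_right_cancel_iff] at hn
    have ham : a ∈ maximalIdeal A := hm a (by simp)
    obtain ⟨ha, hrs⟩ := (isRegular_cons_iff _ _ _).1 hrs
    have hMa : ¬ IsAssociatedPrime (maximalIdeal A) (QuotSMulTop a M) := fun h =>
      ((isRegular_cons_iff _ _ _).1 hrs).1.notMem_of_isAssociatedPrime h (hm b' (by simp))
    have hMx : ¬ IsAssociatedPrime (maximalIdeal A) (QuotSMulTop x M) := fun h =>
      hMa (isAssociatedPrime_maximalIdeal_quotSMulTop ham ha hx h)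
    -- This `b` is regular after both `a` and `x`, so it serves as a bridge: the induction
    -- hypothesis is used once modulo `a` and once modulo `b`, and permuting regular sequences links
    -- the two.
    obtain ⟨b, hbm, hba, hbx⟩ := exists_isSMulRegular_of_not_isAssociatedPrime hMa hMx
    obtain ⟨ss, hss, hssm, hssr⟩ := ih hrs (fun r hr => hm r (List.mem_cons_of_mem _ hr)) hbm hba hn
    have h1 : IsRegular M (a :: b :: ss) := by
      rw [isRegular_cons_iff, isRegular_cons_iff]
      exact ⟨ha, hba, hssr⟩
    have h2 := isRegular_of_perm h1 (List.Perm.swap b a ss)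
    rw [isRegular_cons_iff] at h2
    have h3 : IsWeaklyRegular M [x, b] := by
      rw [isWeaklyRegular_cons_iff, isWeaklyRegular_singleton_iff]
      exact ⟨hx, hbx⟩
    have h4 := isWeaklyRegular_of_perm_of_subset_maximalIdeal h3 (List.Perm.swap b x [])
      (List.forall_mem_cons.2 ⟨hxm, by simpa using hbm⟩)
    rw [isWeaklyRegular_cons_iff, isWeaklyRegular_singleton_iff] at h4
    obtain ⟨ts, hts, htsm, htsr⟩ := ih h2.2 (List.forall_mem_cons.2 ⟨ham, hssm⟩) hxm h4.2 hss
    have h5 : IsRegular M (b :: x :: ts) := by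
      rw [isRegular_cons_iff, isRegular_cons_iff]
      exact ⟨h2.1, h4.2, htsr⟩
    have h6 := isRegular_of_perm h5 (List.Perm.swap x b ts)
    rw [isRegular_cons_iff] at h6
    exact ⟨b :: ts, by simp [hts], List.forall_mem_cons.2 ⟨hbm, htsm⟩, h6.2⟩

/-- If the maximal ideal is the only prime containing `q` and `fs`, then every chain of primes above
`q` has length at most `fs.length`. -/
theorem coheight_le_length_of_forall_eq_maximalIdeal {q : Ideal A} (hq : q.IsPrime)
    (fs : List A) (hfm : ∀ f ∈ fs, f ∈ maximalIdeal A)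
    (hfs : ∀ p : Ideal A, p.IsPrime → q ≤ p → (∀ f ∈ fs, f ∈ p) → p = maximalIdeal A) :
    Order.coheight (⟨q, hq⟩ : PrimeSpectrum A) ≤ fs.length := by
  classical
  have : Nontrivial (A ⧸ q) := Ideal.Quotient.nontrivial_iff.2 hq.ne_top
  have : IsLocalRing (A ⧸ q) := .of_surjective' (Ideal.Quotient.mk q) Ideal.Quotient.mk_surjective
  have h1 : (Order.coheight (⟨q, hq⟩ : PrimeSpectrum A) : WithBot ℕ∞) = ringKrullDim (A ⧸ q) := by
    rw [Order.coheight_eq_krullDim_Ici, ringKrullDim_quotient]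
    rfl
  rw [← WithBot.coe_le_coe, h1, ← maximalIdeal_height_eq_ringKrullDim, WithBot.coe_le_coe]
  have h2 : maximalIdeal (A ⧸ q) ∈
      (Ideal.span ((fs.map (Ideal.Quotient.mk q)).toFinset : Set (A ⧸ q))).minimalPrimes := by
    have key : ∀ P : Ideal (A ⧸ q), P.IsPrime → (∀ f ∈ fs, Ideal.Quotient.mk q f ∈ P) →
        P = maximalIdeal (A ⧸ q) := by
      intro P hP hfP
      have hcomap : P.comap (Ideal.Quotient.mk q) = maximalIdeal A := by
        refine hfs _ inferInstance (fun a ha => ?_) hfP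
        rw [Ideal.mem_comap, Ideal.Quotient.eq_zero_iff_mem.2 ha]
        exact P.zero_mem
      rw [← Ideal.map_comap_of_surjective _ Ideal.Quotient.mk_surjective P, hcomap,
        map_maximalIdeal_of_surjective _ Ideal.Quotient.mk_surjective]
    refine ⟨⟨inferInstance, ?_⟩, fun P ⟨hP, hle⟩ _ => (key P hP fun f hf => hle ?_).ge⟩
    · rw [Ideal.span_le]
      intro b hb
      simp only [List.coe_toFinset, List.mem_map, Set.mem_ofPred_eq] at hb
      obtain ⟨f, hf, rfl⟩ := hb
      rw [← map_maximalIdeal_of_surjective _ (Ideal.Quotient.mk_surjective (I := q))]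
      exact Ideal.mem_map_of_mem _ (hfm f hf)
    · exact Ideal.subset_span (by simpa using ⟨f, hf, rfl⟩)
  refine (Ideal.height_le_card_of_mem_minimalPrimes_span_finset h2).trans ?_
  exact_mod_cast (List.toFinset_card_le _).trans (by simp)

/-- In a Cohen–Macaulay module, systems of parameters are regular sequences. -/
theorem isWeaklyRegular_of_forall_eq_maximalIdeal {M : Type*} [AddCommGroup M] [Module A M]
    [Module.Finite A M] {rs : List A} (hrs : IsRegular M rs)
    (hm : ∀ r ∈ rs, r ∈ maximalIdeal A) {fs : List A} (hlen : fs.length ≤ rs.length)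
    (hfm : ∀ f ∈ fs, f ∈ maximalIdeal A)
    (hfs : ∀ p : Ideal A, p.IsPrime → Module.annihilator A M ≤ p → (∀ f ∈ fs, f ∈ p) →
      p = maximalIdeal A) : IsWeaklyRegular M fs := by
  induction fs generalizing M rs with
  | nil => exact IsWeaklyRegular.nil _ _
  | cons f fs ih =>
    obtain _ | ⟨a, rs⟩ := rs
    · simp at hlen
    simp only [List.length_cons, Nat.add_le_add_iff_right] at hlen
    have hf : IsSMulRegular M f := by
      -- If `f` lay in an associated prime `q`, the remaining elements alone would cut `A / q` down
      -- to the closed point, so its dimension would be smaller than the length of `rs`.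
      refine isSMulRegular_of_forall_notMem_associatedPrime fun q hq hfq => ?_
      have hle : Module.annihilator A M ≤ q := by
        rw [← Submodule.annihilator_top]
        exact hq.annihilator_le
      have h1 := coheight_le_length_of_forall_eq_maximalIdeal hq.isPrime fs
        (fun g hg => hfm g (by simp [hg])) fun p hp hqp hfp =>
        hfs p hp (hle.trans hqp) (by simpa using ⟨hqp hfq, hfp⟩)
      have h2 := (hrs.length_le_coheight hm hq).trans h1
      rw [List.length_cons, Nat.cast_le] at h2
      omega
    obtain ⟨ss, hss, hssm, hssr⟩ := exists_isRegular_quotSMulTop hrs hm (hfm f (by simp)) hf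
    rw [isWeaklyRegular_cons_iff]
    refine ⟨hf, ih hssr hssm (by omega) (fun g hg => hfm g (by simp [hg])) fun p hp hle hfp => ?_⟩
    refine hfs p hp (le_trans ?_ hle) ?_
    · exact LinearMap.annihilator_le_of_surjective _ (Submodule.mkQ_surjective _)
    · have : f ∈ Module.annihilator A (QuotSMulTop f M) := by
        rw [Module.mem_annihilator]
        intro m
        obtain ⟨m, rfl⟩ := Submodule.Quotient.mk_surjective _ m
        rw [← Submodule.Quotient.mk_smul, Submodule.Quotient.mk_eq_zero]
        exact Submodule.smul_mem_pointwise_smul _ _ _ trivial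
      simpa using ⟨hle this, hfp⟩

end RegularSequences

/-! ### Regular local rings are Cohen–Macaulay domains -/

section RegularLocalRings

open IsLocalRing RingTheory.Sequence Pointwise

/-- An element of `𝔪 \ 𝔪²` is part of a minimal system of generators of `𝔪`. -/
theorem IsLocalRing.spanFinrank_maximalIdeal_quotient_lt {A : Type*} [CommRing A] [IsLocalRing A]
    [IsNoetherianRing A] {x : A} [IsLocalRing (A ⧸ Ideal.span {x})]
    (hx : x ∈ maximalIdeal A) (hx2 : x ∉ maximalIdeal A ^ 2) :
    (maximalIdeal (A ⧸ Ideal.span {x})).spanFinrank + 1 ≤ (maximalIdeal A).spanFinrank := by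
  classical
  obtain ⟨S, hcard, hS⟩ := Submodule.FG.exists_span_finset_card_eq_spanFinrank
    (maximalIdeal A).fg_of_isNoetherianRing
  have hSm : ∀ s ∈ S, s ∈ maximalIdeal A := fun s hs => hS ▸ Submodule.subset_span hs
  obtain ⟨a, -, ha⟩ := Submodule.mem_span_finset.1 (hS ▸ hx : x ∈ Submodule.span A (S : Set A))
  -- Were all coefficients in `𝔪`, `x` would lie in `𝔪²`. A generator with unit coefficient becomes
  -- redundant modulo `x`.
  obtain ⟨s, hs, hu⟩ : ∃ s ∈ S, IsUnit (a s) := by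
    by_contra! h
    refine hx2 (ha ▸ sum_mem fun s hs => ?_)
    rw [smul_eq_mul, pow_two]
    exact Ideal.mul_mem_mul (h s hs) (hSm s hs)
  have hmap : maximalIdeal (A ⧸ Ideal.span {x}) =
      Submodule.span _ (((S.erase s).image (Ideal.Quotient.mk (Ideal.span {x})) : Finset _) :
        Set (A ⧸ Ideal.span {x})) := by
    have hsub : ∀ t ∈ S.erase s, Ideal.Quotient.mk (Ideal.span {x}) t ∈ Submodule.span
        (A ⧸ Ideal.span {x}) (((S.erase s).image (Ideal.Quotient.mk (Ideal.span {x})) : Finset _) :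
        Set (A ⧸ Ideal.span {x})) := fun t ht =>
      Submodule.subset_span (Finset.mem_coe.2 (Finset.mem_image_of_mem _ ht))
    rw [← map_maximalIdeal_of_surjective _ Ideal.Quotient.mk_surjective, ← hS]
    refine le_antisymm ?_ (Submodule.span_le.2 ?_)
    · refine (Ideal.map_span _ _).trans_le (Ideal.span_le.2 ?_)
      rintro _ ⟨t, ht, rfl⟩
      rcases eq_or_ne t s with rfl | hts
      · have h1 : Ideal.Quotient.mk (Ideal.span {x}) (a t) * Ideal.Quotient.mk _ t =
            -∑ r ∈ S.erase t, Ideal.Quotient.mk (Ideal.span {x}) (a r) * Ideal.Quotient.mk _ r := by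
          rw [eq_neg_iff_add_eq_zero, Finset.add_sum_erase S
            (fun r => Ideal.Quotient.mk (Ideal.span {x}) (a r) * Ideal.Quotient.mk _ r) hs]
          simp only [← map_mul, ← map_sum]
          rw [Ideal.Quotient.eq_zero_iff_mem]
          simp only [smul_eq_mul] at ha
          rw [ha]
          exact Ideal.mem_span_singleton_self x
        refine (Ideal.unit_mul_mem_iff_mem _ (hu.map (Ideal.Quotient.mk (Ideal.span {x})))).1 ?_
        rw [h1]
        exact neg_mem (sum_mem fun r hr => Ideal.mul_mem_left _ _ (hsub r hr))
      · exact hsub t (Finset.mem_erase.2 ⟨hts, ht⟩)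
    · intro b hb
      obtain ⟨t, ht, rfl⟩ := Finset.mem_image.1 (Finset.mem_coe.1 hb)
      exact Ideal.mem_map_of_mem _ (Submodule.subset_span (Finset.mem_of_mem_erase ht))
  rw [hmap, ← hcard, ← Finset.card_erase_add_one hs]
  gcongr
  refine (Submodule.spanFinrank_span_le_ncard_of_finite (Finset.finite_toSet _)).trans ?_
  rw [Set.ncard_coe_finset]
  exact Finset.card_image_le

theorem IsLocalRing.isLocalRing_quotient_span_singleton {A : Type*} [CommRing A] [IsLocalRing A]
    {x : A} (hx : x ∈ maximalIdeal A) : IsLocalRing (A ⧸ Ideal.span {x}) := by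
  have hne : Ideal.span {x} ≠ ⊤ := fun h =>
    (maximalIdeal.isMaximal A).ne_top (top_le_iff.1 (h ▸ (Ideal.span_singleton_le_iff_mem _).2 hx))
  have : Nontrivial (A ⧸ Ideal.span {x}) := Ideal.Quotient.nontrivial_iff.2 hne
  exact .of_surjective' (Ideal.Quotient.mk _) Ideal.Quotient.mk_surjective

/-- The quotient of a regular local ring by an element of `𝔪 \ 𝔪²` is regular. -/
theorem IsRegularLocalRing.quotient_span_singleton {A : Type*} [CommRing A] [IsRegularLocalRing A]
    {x : A} (hx : x ∈ maximalIdeal A) (hx2 : x ∉ maximalIdeal A ^ 2) :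
    IsRegularLocalRing (A ⧸ Ideal.span {x}) := by
  have := isLocalRing_quotient_span_singleton hx
  refine .of_spanFinrank_maximalIdeal_le _ ?_
  -- The number of generators drops by at least one, the dimension by at most one.
  have h1 := spanFinrank_maximalIdeal_quotient_lt hx hx2
  have h2 := Ideal.height_le_ringKrullDim_quotient_add_one hx
  rw [maximalIdeal_height_eq_ringKrullDim, ← IsRegularLocalRing.spanFinrank_maximalIdeal] at h2
  have h3 := ((Nat.cast_le (α := WithBot ℕ∞)).2 h1).trans h2
  rw [Nat.cast_add] at h3
  exact ENat.WithBot.add_le_add_natCast_right_iff.1 h3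

/-- A regular local ring that is not a field has an element of `𝔪 \ 𝔪²` that is in no minimal
prime. -/
theorem IsRegularLocalRing.exists_mem_maximalIdeal {A : Type*} [CommRing A] [IsRegularLocalRing A]
    (h : ringKrullDim A ≠ 0) :
    ∃ x ∈ maximalIdeal A, x ∉ maximalIdeal A ^ 2 ∧ ∀ q ∈ minimalPrimes A, x ∉ q := by
  classical
  have hfin : (insert (maximalIdeal A ^ 2) (minimalPrimes A)).Finite :=
    (minimalPrimes.finite_of_isNoetherianRing A).insert _
  -- Here `𝔪²` is the non-prime member that prime avoidance tolerates.
  have h1 := (Ideal.subset_union_prime (s := hfin.toFinset) (f := fun q : Ideal A => q)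
    (maximalIdeal A ^ 2) (maximalIdeal A ^ 2) (fun q hq hne _ => by
      rw [Set.Finite.mem_toFinset] at hq
      exact (hq.resolve_left hne).1.1) (I := maximalIdeal A)).not.2 (by
      rintro ⟨q, hq, hle⟩
      rw [Set.Finite.mem_toFinset] at hq
      obtain rfl | hq := hq
      · have hbot : maximalIdeal A = ⊥ := Submodule.eq_bot_of_le_smul_of_le_jacobson_bot
          (maximalIdeal A) _ (IsNoetherian.noetherian _) (by rwa [smul_eq_mul, ← pow_two])
          (maximalIdeal_le_jacobson _)
        exact h (ringKrullDim_eq_zero_of_isField (isField_iff_maximalIdeal_eq.2 hbot))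
      · have hqp : q.IsPrime := hq.1.1
        have := (maximalIdeal.isMaximal A).eq_of_le hqp.ne_top hle
        subst this
        refine h ?_
        rw [← maximalIdeal_height_eq_ringKrullDim, Ideal.height_eq_zero_iff.2 hq]
        rfl)
  obtain ⟨x, hx, hx'⟩ := Set.not_subset.1 h1
  have hx'' : ∀ q ∈ insert (maximalIdeal A ^ 2) (minimalPrimes A), x ∉ q := fun q hq hxq =>
    hx' (Set.mem_iUnion₂_of_mem (by simpa using hq) hxq)
  exact ⟨x, hx, hx'' _ (Or.inl rfl), fun q hq => hx'' q (Or.inr hq)⟩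

theorem IsRegularLocalRing.exists_ringKrullDim_eq (A : Type*) [CommRing A]
    [IsRegularLocalRing A] : ∃ d : ℕ, ringKrullDim A = d :=
  ⟨_, IsRegularLocalRing.spanFinrank_maximalIdeal.symm⟩

/-- Induction on the dimension. For `x` in `𝔪 \ 𝔪²` outside all minimal primes, `A / (x)` is a
domain, so `(x)` is prime and contains a minimal prime `q`. From `x ∉ q` follows `q = xq`, and
Nakayama gives `q = 0`. -/
theorem IsRegularLocalRing.isDomain (A : Type*) [CommRing A] [IsRegularLocalRing A] :
    IsDomain A := by
  obtain ⟨d, hd⟩ := exists_ringKrullDim_eq A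
  induction d using Nat.strong_induction_on generalizing A with
  | _ d ih =>
  rcases Nat.eq_zero_or_pos d with rfl | hpos
  · have h0 : (maximalIdeal A).spanFinrank = 0 := by
      have := (IsRegularLocalRing.spanFinrank_maximalIdeal (R := A)).trans hd
      exact_mod_cast this
    rw [Submodule.spanFinrank_eq_zero_iff_eq_bot (IsNoetherian.noetherian _)] at h0
    exact (isField_iff_maximalIdeal_eq.2 h0).isDomain
  · obtain ⟨x, hxm, hx2, hxq⟩ := exists_mem_maximalIdeal (A := A)
      (by rw [hd]; exact_mod_cast hpos.ne')
    have := quotient_span_singleton hxm hx2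
    obtain ⟨e, he⟩ := exists_ringKrullDim_eq (A ⧸ Ideal.span {x})
    have hlt : e < d := by
      have h1 := IsLocalRing.spanFinrank_maximalIdeal_quotient_lt hxm hx2
      rw [← Nat.cast_le (α := WithBot ℕ∞), Nat.cast_add, spanFinrank_maximalIdeal,
        spanFinrank_maximalIdeal, hd, he] at h1
      exact_mod_cast h1
    have hdom := ih e hlt _ he
    have hprime : (Ideal.span {x}).IsPrime := (Ideal.Quotient.isDomain_iff_prime _).1 hdom
    obtain ⟨q, hq, hle⟩ := Ideal.exists_minimalPrimes_le (I := (⊥ : Ideal A)) (J := Ideal.span {x})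
      bot_le
    have hqp : q.IsPrime := hq.1.1
    have hq0 : q = ⊥ := by
      refine Submodule.eq_bot_of_le_smul_of_le_jacobson_bot (Ideal.span {x}) q
        (IsNoetherian.noetherian _) (fun a ha => ?_) ?_
      · obtain ⟨b, rfl⟩ := Ideal.mem_span_singleton'.1 (hle ha)
        have hb : b ∈ q := (hqp.mem_or_mem ha).resolve_right (hxq q hq)
        rw [mul_comm]
        exact Submodule.smul_mem_smul (Ideal.mem_span_singleton_self x) hb
      · rw [Ideal.span_singleton_le_iff_mem]
        exact maximalIdeal_le_jacobson _ hxm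
    subst hq0
    exact IsDomain.of_bot_isPrime A

/-- A regular local ring has a regular sequence whose length is the dimension. -/
theorem IsRegularLocalRing.exists_isRegular (A : Type*) [CommRing A] [IsRegularLocalRing A] :
    ∃ rs : List A, (rs.length : WithBot ℕ∞) = ringKrullDim A ∧
      (∀ r ∈ rs, r ∈ maximalIdeal A) ∧ IsRegular A rs := by
  obtain ⟨d, hd⟩ := exists_ringKrullDim_eq A
  induction d generalizing A with
  | zero => exact ⟨[], by simp [hd], by simp, IsRegular.nil _ _⟩
  | succ d ih =>
    have := isDomain A
    obtain ⟨x, hxm, hx2, hxq⟩ := exists_mem_maximalIdeal (A := A)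
      (by rw [hd]; exact_mod_cast d.succ_ne_zero)
    have hreg := quotient_span_singleton hxm hx2
    have hx0 : x ≠ 0 := by rintro rfl; exact hx2 (zero_mem _)
    have hxr : IsSMulRegular A x := (IsRegular.of_ne_zero hx0).left.isSMulRegular
    have hdim : ringKrullDim (A ⧸ Ideal.span {x}) = d := by
      have := ringKrullDim_quotient_span_singleton_succ_eq_ringKrullDim hxr hxm
      obtain ⟨e, he⟩ := exists_ringKrullDim_eq (A ⧸ Ideal.span {x})
      rw [hd, he] at this
      rw [he]
      have : e + 1 = d + 1 := by exact_mod_cast this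
      congr 1
      exact_mod_cast congrArg (fun n : ℕ => (n : WithBot ℕ∞)) (Nat.succ_injective this)
    obtain ⟨rs, hlen, hrm, hrs⟩ := ih _ hdim
    obtain ⟨ss, rfl⟩ := (List.map_surjective_iff.2
      (Ideal.Quotient.mk_surjective (I := Ideal.span {x}))) rs
    refine ⟨x :: ss, ?_, ?_, ?_⟩
    · rw [hd]
      rw [hdim, List.length_map] at hlen
      rw [List.length_cons, Nat.cast_add, Nat.cast_add, hlen]
    · refine List.forall_mem_cons.2 ⟨hxm, fun r hr hu => ?_⟩
      exact hrm _ (List.mem_map_of_mem hr) (hu.map (Ideal.Quotient.mk (Ideal.span {x})))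
    · rw [isRegular_cons_iff]
      refine ⟨hxr, ?_⟩
      have hspan : x • (⊤ : Ideal A) = Ideal.span {x} := by
        rw [← Submodule.ideal_span_singleton_smul, smul_eq_mul, Ideal.mul_top]
      -- Regularity over the ring `A / (x)` is carried over to the `A`-module `A / xA`.
      refine (AddEquiv.isRegular_congr (e := (Submodule.quotEquivOfEq _ _ hspan).toAddEquiv)
        (bs := ss.map (Ideal.Quotient.mk (Ideal.span {x}))) ?_).2 hrs
      refine List.forall₂_map_right_iff.2 (List.forall₂_same.2 fun r _ y => ?_)
      exact (Submodule.quotEquivOfEq _ _ hspan).map_smul r y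

end RegularLocalRings

/-! ### Parameters at a nondegenerate prime -/

section SystemsOfParameters

open IsLocalRing RingTheory.Sequence

/-- In a regular ring, let the prime `p` of height `c` be minimal over `f₁, …, f_c`. Then the images
of `f₁, …, f_c` in the localization at `p` form a regular sequence; this is stated without mention
of the localization. -/
theorem IsRegularRing.exists_mul_mem_span_of_mem_minimalPrimes {R : Type*} [CommRing R]
    [IsRegularRing R] {c : ℕ} (f : Fin c → R) {p : Ideal R}
    (hp : p ∈ (Ideal.span (Set.range f)).minimalPrimes) (hht : p.height = c) {k : ℕ} (hk : k < c)
    {s a : R} (hs : s ∉ p)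
    (h : s * (f ⟨k, hk⟩ * a) ∈ Ideal.span {r | ∃ i : Fin c, i.1 < k ∧ f i = r}) :
    ∃ t ∉ p, t * a ∈ Ideal.span {r | ∃ i : Fin c, i.1 < k ∧ f i = r} := by
  have hpp : p.IsPrime := hp.1.1
  let A := Localization.AtPrime p
  obtain ⟨rs, hlen, hrm, hrs⟩ := IsRegularLocalRing.exists_isRegular A
  rw [IsLocalization.AtPrime.ringKrullDim_eq_height p A, hht] at hlen
  have hlen' : rs.length = c := by exact_mod_cast hlen
  let fs : List A := List.ofFn fun i => algebraMap R A (f i)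
  have hfp : ∀ i, f i ∈ p := fun i => hp.1.2 (Ideal.subset_span ⟨i, rfl⟩)
  have hreg : IsWeaklyRegular A fs := by
    refine isWeaklyRegular_of_forall_eq_maximalIdeal hrs hrm (by simp [fs, hlen']) ?_ ?_
    · intro g hg
      obtain ⟨i, rfl⟩ := (List.mem_ofFn' _ _).1 hg
      exact (IsLocalization.AtPrime.to_map_mem_maximal_iff A p (f i)).2 (hfp i)
    -- Minimality of `p` over the `fᵢ` makes the maximal ideal of `A` the only prime containing
    -- their images.
    · intro P hP _ hfP
      have hle : P.under R ≤ p := by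
        exact (Ideal.comap_mono (le_maximalIdeal hP.ne_top)).trans
          (IsLocalization.AtPrime.under_maximalIdeal A p).le
      have hge : p ≤ P.under R := by
        refine hp.2 ⟨inferInstance, Ideal.span_le.2 ?_⟩ hle
        rintro _ ⟨i, rfl⟩
        exact hfP _ ((List.mem_ofFn' _ _).2 ⟨i, rfl⟩)
      have heq : P.under R = p := le_antisymm hle hge
      rw [← IsLocalization.map_under p.primeCompl A P, heq,
        Localization.AtPrime.map_eq_maximalIdeal]
  have hk' : k < fs.length := by simpa [fs] using hk
  have hmap : (Ideal.ofList (fs.take k) • ⊤ : Ideal A) =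
      (Ideal.span {r | ∃ i : Fin c, i.1 < k ∧ f i = r}).map (algebraMap R A) := by
    rw [smul_eq_mul, Ideal.mul_top, Ideal.map_span]
    refine congrArg Ideal.span ?_
    ext g
    simp only [Set.mem_ofPred_eq, Set.mem_image, List.mem_take_iff_getElem, fs]
    constructor
    · rintro ⟨j, hj, rfl⟩
      simp only [List.length_ofFn] at hj
      exact ⟨_, ⟨⟨j, by omega⟩, by simp; omega, rfl⟩, by simp⟩
    · rintro ⟨_, ⟨i, hi, rfl⟩, rfl⟩
      exact ⟨i, by simp [hi], by simp⟩
  have hreg' := hreg.regular_mod_prev k hk'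
  rw [isSMulRegular_quotient_iff_mem_of_smul_mem, hmap] at hreg'
  have hfk : fs[k] = algebraMap R A (f ⟨k, hk⟩) := by simp [fs]
  have h1 : algebraMap R A a ∈
      (Ideal.span {r | ∃ i : Fin c, i.1 < k ∧ f i = r}).map (algebraMap R A) := by
    apply hreg'
    rw [hfk, smul_eq_mul, ← map_mul]
    exact (IsLocalization.algebraMap_mem_map_algebraMap_iff p.primeCompl A _ _).2 ⟨s, hs, h⟩
  obtain ⟨t, ht, hta⟩ := (IsLocalization.algebraMap_mem_map_algebraMap_iff p.primeCompl A _ _).1 h1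
  exact ⟨t, ht, hta⟩

end SystemsOfParameters

/-! ### Ideal quotients and saturations -/

namespace NondegenerateLocus

section IdealQuotients

variable {R : Type*} [CommRing R] {I J p : Ideal R}

theorem mem_quot {a : R} : a ∈ quot I J ↔ ∀ b ∈ J, a * b ∈ I :=
  Submodule.mem_colon

theorem quot_mul_le (I J : Ideal R) : quot I J * J ≤ I :=
  Ideal.mul_le.2 fun _ ha _ hb => mem_quot.1 ha _ hb

theorem mem_sat {a : R} : a ∈ sat I J ↔ ∃ m, a ∈ quot I (J ^ m) :=
  Submodule.mem_iSup_of_directed _ (Monotone.directed_le fun _ _ h =>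
    Submodule.colon_mono le_rfl (Ideal.pow_le_pow_right h))

theorem le_sat (I J : Ideal R) : I ≤ sat I J := fun _ ha =>
  mem_sat.2 ⟨0, mem_quot.2 fun b _ => I.mul_mem_right b ha⟩

theorem sat_le_of_not_le [IsNoetherianRing R] (hp : p.IsPrime) (hI : I ≤ p) (hJ : ¬ J ≤ p) :
    sat I J ≤ p := by
  intro a ha
  obtain ⟨m, hm⟩ := mem_sat.1 ha
  obtain ⟨b, hb, hbp⟩ := SetLike.not_le_iff_exists.1 hJ
  refine (hp.mem_or_mem (hI (mem_quot.1 hm _ (Ideal.pow_mem_pow hb m)))).resolve_right ?_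
  exact fun h => hbp (hp.mem_of_pow_mem m h)

/-- The minimal primes of `I : J^∞` are minimal primes of `I` that do not contain `J`. -/
theorem mem_minimalPrimes_of_mem_minimalPrimes_sat [IsNoetherianRing R]
    (hp : p ∈ (sat I J).minimalPrimes) : p ∈ I.minimalPrimes ∧ ¬ J ≤ p := by
  have hpp : p.IsPrime := hp.1.1
  have hJ : ¬ J ≤ p := by
    intro hJ
    obtain ⟨y, hy⟩ : ∃ y, p = Submodule.colon (sat I J) {y} := by
      refine Submodule.exists_eq_colon_of_mem_minimalPrimes (x := (1 : R)) ?_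
      convert hp using 2
      ext a
      rw [Submodule.mem_colon_singleton, smul_eq_mul, mul_one]
    obtain ⟨N, hN⟩ := exists_sat_eq I J
    -- If `J ≤ p`, then `J y` lies in `I : J^N`, so `J^(N+1) y` lies in `I`; the saturation being
    -- stable from `N` on, it contains `y`.
    have h1 : y ∈ sat I J := by
      rw [hN (N + 1) (by omega), pow_succ', mem_quot]
      intro b hb
      refine Submodule.mul_induction_on hb (fun u hu v hv => ?_) fun u v hu hv => ?_
      · have h2 := hJ hu
        rw [hy, Submodule.mem_colon_singleton, hN N le_rfl] at h2
        have := mem_quot.1 h2 v hv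
        rwa [smul_eq_mul, mul_comm u y, mul_assoc] at this
      · rw [mul_add]
        exact add_mem hu hv
    refine hpp.ne_top ((Ideal.eq_top_iff_one _).2 ?_)
    rw [hy, Submodule.mem_colon_singleton, one_smul]
    exact h1
  refine ⟨⟨⟨hpp, (le_sat I J).trans hp.1.2⟩, fun q ⟨hq, hIq⟩ hqp => ?_⟩, hJ⟩
  exact hp.2 ⟨hq, sat_le_of_not_le hq hIq fun h => hJ (h.trans hqp)⟩ hqp

/-- For a finitely generated ideal, elementwise denominators outside `p` have a common multiple. -/
theorem exists_forall_mul_mem [IsNoetherianRing R] (hp : p.IsPrime)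
    (h : ∀ a ∈ J, ∃ s ∉ p, s * a ∈ I) : ∃ s ∉ p, ∀ a ∈ J, s * a ∈ I := by
  classical
  obtain ⟨S, rfl⟩ := IsNoetherian.noetherian J
  choose! s hs hsa using h
  refine ⟨∏ a ∈ S, s a, ?_, fun a ha => ?_⟩
  · rw [hp.prod_mem_iff]
    push Not
    exact fun a ha => hs a (Submodule.subset_span ha)
  · induction ha using Submodule.span_induction with
    | mem a ha =>
      rw [← Finset.prod_erase_mul S s ha, mul_assoc]
      exact I.mul_mem_left _ (hsa a (Submodule.subset_span ha))
    | zero => simp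
    | add u v _ _ hu hv => rw [mul_add]; exact add_mem hu hv
    | smul r u _ hu =>
      rw [smul_eq_mul, mul_left_comm]
      exact I.mul_mem_left _ hu

end IdealQuotients

/-! ### The invariant and its preservation -/

section Invariant

variable {R : Type*} [CommRing R] {c : ℕ}

/-- The ideal generated by the first `k` of the elements `f₁, …, f_c`. -/
def prefixIdeal (f : Fin c → R) (k : ℕ) : Ideal R :=
  Ideal.span {r | ∃ i : Fin c, i.1 < k ∧ f i = r}

theorem prefixIdeal_self (f : Fin c → R) : prefixIdeal f c = Ideal.span (Set.range f) := by
  simp [prefixIdeal, Set.range]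

theorem prefixIdeal_succ (f : Fin c → R) {k : ℕ} (hk : k < c) :
    prefixIdeal f (k + 1) = prefixIdeal f k ⊔ Ideal.span {f ⟨k, hk⟩} := by
  rw [prefixIdeal, prefixIdeal, ← Ideal.span_union]
  congr 1
  ext r
  simp only [Set.mem_ofPred_eq, Set.mem_union, Set.mem_singleton_iff, Nat.lt_succ_iff_lt_or_eq]
  constructor
  · rintro ⟨i, hi | hi, rfl⟩
    · exact Or.inl ⟨i, hi, rfl⟩
    · exact Or.inr (congrArg f (Fin.ext hi))
  · rintro (⟨i, hi, rfl⟩ | rfl)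
    · exact ⟨i, Or.inl hi, rfl⟩
    · exact ⟨_, Or.inr rfl, rfl⟩

/-- What the algorithm preserves: `I` is the ideal generated by the inputs that have been processed,
`𝒦` the set of the ideals recorded so far, of which those in `visited` have been removed from `J`. -/
structure Invariant (f : Fin c → R) (k : ℕ) (J : Ideal R) (𝒦 visited : Set (Ideal R)) :
    Prop where
  le_length : k ≤ c
  prefixIdeal_le : prefixIdeal f k ≤ J
  /-- Locally at a nondegenerate component, `J` is generated by `f₁, …, f_k`. -/
  exists_mul_mem : ∀ p ∈ (Ideal.span (Set.range f)).minimalPrimes, p.height = c →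
    ∀ a ∈ J, ∃ s ∉ p, s * a ∈ prefixIdeal f k
  not_le : ∀ p ∈ (Ideal.span (Set.range f)).minimalPrimes, p.height = c → ∀ K ∈ 𝒦, ¬ K ≤ p
  le_or_exists_le : ∀ p : Ideal R, p.IsPrime → prefixIdeal f k ≤ p → J ≤ p ∨ ∃ K ∈ 𝒦, K ≤ p
  le_height : ∀ p ∈ J.minimalPrimes, (k : ℕ∞) ≤ p.height
  not_le_of_visited : ∀ p ∈ J.minimalPrimes, ∀ K ∈ visited, ¬ K ≤ p

theorem Invariant.start (f : Fin c → R) : Invariant f 0 ⊥ ∅ ∅ where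
  le_length := Nat.zero_le c
  prefixIdeal_le := by simp [prefixIdeal]
  exists_mul_mem := fun p hp _ a ha => ⟨1, (Ideal.ne_top_iff_one p).1 hp.1.1.ne_top, by
    rw [Ideal.mem_bot.1 ha, mul_zero]; exact zero_mem _⟩
  not_le := by simp
  le_or_exists_le := fun p _ _ => Or.inl bot_le
  le_height := by simp
  not_le_of_visited := by simp

/-- At a nondegenerate prime `K` is locally the unit ideal, so saturating by it changes nothing
there. Elsewhere it only discards the minimal primes of `J` that contain `K`, which keeps the height
bound and the earlier removals. -/
theorem Invariant.clean [IsNoetherianRing R] {f : Fin c → R} {k : ℕ} {J : Ideal R}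
    {𝒦 visited : Set (Ideal R)} (h : Invariant f k J 𝒦 visited) {K : Ideal R} (hK : K ∈ 𝒦) :
    Invariant f k (sat J K) 𝒦 (insert K visited) where
  le_length := h.le_length
  prefixIdeal_le := h.prefixIdeal_le.trans (le_sat J K)
  exists_mul_mem := by
    intro p hp hht a ha
    have hpp : p.IsPrime := hp.1.1
    obtain ⟨m, hm⟩ := mem_sat.1 ha
    obtain ⟨b, hb, hbp⟩ := SetLike.not_le_iff_exists.1 (h.not_le p hp hht K hK)
    obtain ⟨s, hs, hsa⟩ := h.exists_mul_mem p hp hht _ (mem_quot.1 hm _ (Ideal.pow_mem_pow hb m))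
    refine ⟨s * b ^ m, fun hmem => ?_, by rwa [mul_assoc, mul_comm (b ^ m)]⟩
    exact (hpp.mem_or_mem hmem).elim hs fun h => hbp (hpp.mem_of_pow_mem m h)
  not_le := h.not_le
  le_or_exists_le := by
    intro p hp hle
    by_cases hKp : K ≤ p
    · exact Or.inr ⟨K, hK, hKp⟩
    · exact (h.le_or_exists_le p hp hle).imp_left fun hJ => sat_le_of_not_le hp hJ hKp
  le_height := fun p hp => h.le_height p (mem_minimalPrimes_of_mem_minimalPrimes_sat hp).1
  not_le_of_visited := by
    intro p hp
    obtain ⟨hpJ, hpK⟩ := mem_minimalPrimes_of_mem_minimalPrimes_sat hp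
    rintro _ (rfl | hK')
    · exact hpK
    · exact h.not_le_of_visited p hpJ _ hK'

/-- With `H = J : f_k^∞`, regularity of `f_k` gives `H = J` locally at nondegenerate primes, so `J :
H` is the unit ideal there. No minimal prime of `H` contains `f_k`, so adding `f_k` raises the
height bound by one. -/
theorem Invariant.body [IsRegularRing R] {f : Fin c → R} {k : ℕ} {J : Ideal R}
    {𝒦 visited : Set (Ideal R)} (h : Invariant f k J 𝒦 visited) (hk : k < c) :
    Invariant f (k + 1) (sat J (Ideal.span {f ⟨k, hk⟩}) ⊔ Ideal.span {f ⟨k, hk⟩})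
      (insert (quot J (sat J (Ideal.span {f ⟨k, hk⟩}))) 𝒦) ∅ := by
  have hloc : ∀ p ∈ (Ideal.span (Set.range f)).minimalPrimes, p.height = c →
      ∀ a ∈ sat J (Ideal.span {f ⟨k, hk⟩}), ∃ s ∉ p, s * a ∈ prefixIdeal f k := by
    intro p hp hht a ha
    obtain ⟨m, hm⟩ := mem_sat.1 ha
    obtain ⟨s, hs, hsa⟩ := h.exists_mul_mem p hp hht _
      (mem_quot.1 hm _ (Ideal.pow_mem_pow (Ideal.mem_span_singleton_self _) m))
    clear hm
    -- The factors `f_k` are cancelled one at a time, each at the cost of a new denominator outside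
    -- `p`.
    induction m generalizing s with
    | zero => exact ⟨s, hs, by simpa using hsa⟩
    | succ m ih =>
      obtain ⟨t, ht, hta⟩ := IsRegularRing.exists_mul_mem_span_of_mem_minimalPrimes f hp hht hk
        (a := a * f ⟨k, hk⟩ ^ m) hs (by rwa [pow_succ', mul_left_comm a] at hsa)
      exact ih t ht hta
  refine ⟨hk, ?_, ?_, ?_, ?_, ?_, by simp⟩
  · rw [prefixIdeal_succ f hk]
    exact sup_le_sup_right (h.prefixIdeal_le.trans (le_sat _ _)) _
  · intro p hp hht b hb
    obtain ⟨a, ha, g, hg, rfl⟩ := Submodule.mem_sup.1 hb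
    obtain ⟨s, hs, hsa⟩ := hloc p hp hht a ha
    refine ⟨s, hs, ?_⟩
    rw [prefixIdeal_succ f hk, mul_add]
    exact add_mem (Ideal.mem_sup_left hsa) (Ideal.mem_sup_right (Ideal.mul_mem_left _ _ hg))
  · rintro p hp hht _ (rfl | hK)
    -- A common denominator for `H` is an element of `J : H` outside `p`.
    · obtain ⟨s, hs, hsa⟩ := exists_forall_mul_mem hp.1.1 (hloc p hp hht)
      exact fun hle => hs (hle (mem_quot.2 fun a ha => h.prefixIdeal_le (hsa a ha)))
    · exact h.not_le p hp hht _ hK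
  · intro p hp hle
    rw [prefixIdeal_succ f hk, sup_le_iff] at hle
    obtain hJ | ⟨K, hK, hKp⟩ := h.le_or_exists_le p hp hle.1
    -- Since `(J : H) H ≤ J`, a prime over `J` contains one of the two factors: what `H` loses is
    -- recorded in `J : H`.
    · obtain hq | hs := hp.mul_le.1 ((quot_mul_le J (sat J (Ideal.span {f ⟨k, hk⟩}))).trans hJ)
      · exact Or.inr ⟨_, Set.mem_insert _ _, hq⟩
      · exact Or.inl (sup_le hs hle.2)
    · exact Or.inr ⟨K, Set.mem_insert_of_mem _ hK, hKp⟩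
  · intro p hp
    have hpp : p.IsPrime := hp.1.1
    obtain ⟨q, hq, hqp⟩ := Ideal.exists_minimalPrimes_le (le_sup_left.trans hp.1.2)
    have hqprime : q.IsPrime := hq.1.1
    obtain ⟨hqJ, hfq⟩ := mem_minimalPrimes_of_mem_minimalPrimes_sat hq
    have hlt : q < p := lt_of_le_of_ne hqp fun heq =>
      hfq (heq ▸ le_sup_right.trans hp.1.2)
    refine le_trans ?_ (Ideal.height_add_one_le_of_lt_of_isPrime hlt)
    rw [Nat.cast_add, Nat.cast_one]
    gcongr
    exact h.le_height q hqJ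

/-- After the last iteration, the minimal primes of `J` are the primes of height `c` that are
minimal over `f₁, …, f_c`. -/
theorem Invariant.mem_minimalPrimes_iff [IsNoetherianRing R] {f : Fin c → R} {J : Ideal R}
    {𝒦 : Set (Ideal R)} (h : Invariant f c J 𝒦 𝒦) {p : Ideal R} :
    p ∈ J.minimalPrimes ↔ p ∈ (Ideal.span (Set.range f)).minimalPrimes ∧ p.height = c := by
  have hle := h.prefixIdeal_le
  have hloc := h.exists_mul_mem
  have hor := h.le_or_exists_le
  rw [prefixIdeal_self] at hle hor hloc
  constructor
  · intro hp
    have hp' : p ∈ (Ideal.span (Set.range f)).minimalPrimes := by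
      refine ⟨⟨hp.1.1, hle.trans hp.1.2⟩, fun q ⟨hq, hfq⟩ hqp => ?_⟩
      obtain hJ | ⟨K, hK, hKq⟩ := hor q hq hfq
      · exact hp.2 ⟨hq, hJ⟩ hqp
      · exact absurd (hKq.trans hqp) (h.not_le_of_visited p hp K hK)
    refine ⟨hp', le_antisymm ?_ (h.le_height p hp)⟩
    refine (Ideal.height_le_card_of_mem_minimalPrimes_span (Set.finite_range f) hp').trans ?_
    rw [← Set.image_univ]
    exact_mod_cast (Set.ncard_image_le).trans (by simp)
  · rintro ⟨hp, hht⟩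
    have hJ : J ≤ p := fun a ha => by
      obtain ⟨s, hs, hsa⟩ := hloc p hp hht a ha
      exact (hp.1.1.mem_or_mem (hp.1.2 hsa)).resolve_left hs
    exact ⟨⟨hp.1.1, hJ⟩, fun q ⟨hq, hJq⟩ hqp => hp.2 ⟨hq, hle.trans hJq⟩ hqp⟩

end Invariant

/-! ### Runs of the algorithm and termination -/

section Algorithm

variable {R : Type*} [CommRing R] {c : ℕ}

/-- The invariant of the states that occur in a run of the algorithm. -/
def State.Invariant (f : Fin c → R) : State R → Prop
  | .outer k J 𝒦 => NondegenerateLocus.Invariant f k J 𝒦 𝒦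
  | .inner k J 𝒦 rest => rest ⊆ 𝒦 ∧ NondegenerateLocus.Invariant f (k + 1) J 𝒦 (𝒦 \ rest)
  | .returned J => ∃ 𝒦 : Set (Ideal R), NondegenerateLocus.Invariant f c J 𝒦 𝒦

theorem State.Invariant.step [IsRegularRing R] {f : Fin c → R} {s t : State R}
    (hs : s.Invariant f) (h : Step f s t) : t.Invariant f := by
  classical
  cases h with
  | body k hk J H 𝒦 𝒦' hH h𝒦 =>
    subst hH h𝒦
    have h1 := NondegenerateLocus.Invariant.body hs hk
    refine ⟨subset_rfl, ?_⟩
    convert h1 using 1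
    · simp
    · simp
  | clean k J K 𝒦 rest hK =>
    refine ⟨(Finset.erase_subset _ _).trans hs.1, ?_⟩
    convert NondegenerateLocus.Invariant.clean hs.2 (hs.1 hK) using 1
    ext K'
    by_cases h : K' = K
    · subst h
      simpa using hs.1 hK
    · simp [h]
  | next k J 𝒦 => simpa [State.Invariant] using hs
  | ret J 𝒦 => exact ⟨_, hs⟩

theorem Reachable.invariant [IsRegularRing R] {f : Fin c → R} {s : State R}
    (h : Reachable f s) : s.Invariant f := by
  induction h with
  | refl => simpa [State.start, State.Invariant] using NondegenerateLocus.Invariant.start f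
  | tail _ hst ih => exact ih.step hst

/-- A measure that decreases with every step of the algorithm. -/
def State.measure (c : ℕ) : State R → ℕ ×ₗ ℕ
  | .outer k _ _ => toLex (2 * (c - k) + 1, 0)
  -- The maximum with `2` matters only for `k ≥ c`, which no run reaches; it makes the measure drop
  -- there too, to `1` at the next loop head.
  | .inner k _ _ rest => toLex (max (2 * (c - k)) 2, rest.card)
  | .returned _ => toLex (0, 0)

theorem Step.measure_lt {f : Fin c → R} {s t : State R} (h : Step f s t) :
    t.measure c < s.measure c := by
  classical
  cases h with
  | body k hk J H 𝒦 𝒦' hH h𝒦 => exact Prod.Lex.toLex_lt_toLex.2 (Or.inl (by dsimp; omega))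
  | clean k J K 𝒦 rest hK =>
    exact Prod.Lex.toLex_lt_toLex.2 (Or.inr ⟨rfl, Finset.card_erase_lt_of_mem hK⟩)
  | next k J 𝒦 => exact Prod.Lex.toLex_lt_toLex.2 (Or.inl (by dsimp; omega))
  | ret J 𝒦 => exact Prod.Lex.toLex_lt_toLex.2 (Or.inl (by dsimp; omega))

theorem State.Invariant.exists_step {f : Fin c → R} {s : State R} (h : s.Invariant f) :
    (∃ t, Step f s t) ∨ ∃ J, s = State.returned J := by
  cases s with
  | outer k J 𝒦 =>
    obtain hk | rfl := (NondegenerateLocus.Invariant.le_length h).lt_or_eq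
    · exact Or.inl ⟨_, Step.body k hk J _ 𝒦 _ rfl rfl⟩
    · exact Or.inl ⟨_, Step.ret J 𝒦⟩
  | inner k J 𝒦 rest =>
    obtain rfl | ⟨K, hK⟩ := rest.eq_empty_or_nonempty
    · exact Or.inl ⟨_, Step.next k J 𝒦⟩
    · exact Or.inl ⟨_, Step.clean k J K 𝒦 rest hK⟩
  | returned J => exact Or.inr ⟨J, rfl⟩

theorem terminates [IsRegularRing R] (f : Fin c → R) : Terminates f := by
  refine ⟨?_, fun s hs => hs.invariant.exists_step⟩
  rintro ⟨s, -, hs⟩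
  obtain ⟨i, hi⟩ := WellFounded.not_rel_apply_succ (r := (· < ·)) fun i => (s i).measure c
  exact hi (hs i).measure_lt

theorem exists_outputs [IsRegularRing R] (f : Fin c → R) : ∃ J, Outputs f J := by
  have key : ∀ m : ℕ ×ₗ ℕ, ∀ s : State R, s.measure c = m → Reachable f s →
      ∃ J, Outputs f J := by
    intro m
    induction m using WellFoundedLT.induction with
    | _ m ih =>
    rintro s rfl hs
    obtain ⟨t, ht⟩ | ⟨J, rfl⟩ := hs.invariant.exists_step
    · exact ih _ ht.measure_lt t rfl (hs.tail ht)
    · exact ⟨J, hs⟩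
  exact key _ _ rfl Relation.ReflTransGen.refl

end Algorithm

/-! ### Primes and irreducible closed sets over `K` -/

section Geometry

open TopologicalSpace MvPolynomial

variable {K : Type*} (L : Type*) {n : ℕ} [Field K] [Field L] [Algebra K L]

variable {L} in
theorem isClosed_iff_exists_zeros {Z : Set (AffineSpace K L n)} :
    IsClosed Z ↔ ∃ I : Ideal (MvPolynomial (Fin n) K), zeros L I = Z := by
  rw [← isOpen_compl_iff]
  change Zᶜᶜ ∈ Set.range (zeros L) ↔ _
  rw [compl_compl]
  rfl

theorem zeros_anti {I J : Ideal (MvPolynomial (Fin n) K)} (h : I ≤ J) : zeros L J ⊆ zeros L I :=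
  zeroLocus_anti_mono h

/-- This is the Nullstellensatz for polynomials over `K` and points over `L`: a prime `P` is the
vanishing ideal of its zero set. -/
theorem zeros_subset_zeros_iff [IsAlgClosed L] {I P : Ideal (MvPolynomial (Fin n) K)}
    (hP : P.IsPrime) : zeros L P ⊆ zeros L I ↔ I ≤ P := by
  refine ⟨fun h => ?_, zeros_anti L⟩
  have h1 := (le_zeroLocus_iff_le_vanishingIdeal (V := zeroLocus L P) (I := I)).1 h
  rwa [IsPrime.vanishingIdeal_zeroLocus] at h1

theorem isIrreducible_zeros [IsAlgClosed L] {P : Ideal (MvPolynomial (Fin n) K)}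
    (hP : P.IsPrime) : IsIrreducible (zeros L P) := by
  refine ⟨?_, ?_⟩
  · by_contra h
    rw [Set.not_nonempty_iff_eq_empty] at h
    refine hP.ne_top (top_le_iff.1 ((zeros_subset_zeros_iff L hP).1 ?_))
    rw [h]
    exact Set.empty_subset _
  · rw [isPreirreducible_iff_isClosed_union_isClosed]
    rintro Z₁ Z₂ h₁ h₂ h
    obtain ⟨I, rfl⟩ := isClosed_iff_exists_zeros.1 h₁
    obtain ⟨J, rfl⟩ := isClosed_iff_exists_zeros.1 h₂
    rw [← zeros_inf, zeros_subset_zeros_iff L hP] at h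
    exact (hP.inf_le.1 h).imp (zeros_anti L) (zeros_anti L)

theorem isPrime_vanishingIdeal {Z : Set (AffineSpace K L n)} (hZ : IsIrreducible Z) :
    (vanishingIdeal K (K := L) (σ := Fin n) Z).IsPrime := by
  refine ⟨fun h => ?_, fun {p q} hpq => ?_⟩
  · obtain ⟨x, hx⟩ := hZ.nonempty
    have h1 := (Ideal.eq_top_iff_one _).1 h x hx
    rw [map_one] at h1
    exact one_ne_zero h1
  · have hmem : ∀ r : MvPolynomial (Fin n) K,
        Z ⊆ zeros L (Ideal.span {r}) ↔ r ∈ vanishingIdeal K (K := L) (σ := Fin n) Z := fun r => by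
      rw [← Ideal.span_singleton_le_iff_mem]
      exact le_zeroLocus_iff_le_vanishingIdeal
    rw [← hmem, ← hmem]
    refine isPreirreducible_iff_isClosed_union_isClosed.1 hZ.isPreirreducible _ _
      (isClosed_iff_exists_zeros.2 ⟨_, rfl⟩) (isClosed_iff_exists_zeros.2 ⟨_, rfl⟩) fun x hx => ?_
    have h1 := hpq x hx
    rw [map_mul] at h1
    refine (mul_eq_zero.1 h1).imp (fun h0 r hr => ?_) fun h0 r hr => ?_
    all_goals
      obtain ⟨a, rfl⟩ := Ideal.mem_span_singleton'.1 hr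
      rw [map_mul, h0, mul_zero]

theorem zeros_vanishingIdeal {Z : Set (AffineSpace K L n)} (hZ : IsClosed Z) :
    zeros L (vanishingIdeal K (K := L) (σ := Fin n) Z) = Z := by
  obtain ⟨I, rfl⟩ := isClosed_iff_exists_zeros.1 hZ
  exact Set.Subset.antisymm (zeros_anti L (le_vanishingIdeal_zeroLocus I))
    (zeroLocus_vanishingIdeal_le _)

/-- The irreducible closed sets of `Lⁿ` correspond to the prime ideals of `K[x₁, …, xₙ]`. -/
noncomputable def irreducibleClosedsOrderIso [IsAlgClosed L] :
    IrreducibleCloseds (AffineSpace K L n) ≃o (PrimeSpectrum (MvPolynomial (Fin n) K))ᵒᵈ :=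
  OrderIso.symm
  { toFun := fun P => ⟨zeros L P.ofDual.asIdeal, isIrreducible_zeros L P.ofDual.isPrime,
      isClosed_iff_exists_zeros.2 ⟨_, rfl⟩⟩
    invFun := fun Z => OrderDual.toDual ⟨_, isPrime_vanishingIdeal L Z.isIrreducible⟩
    left_inv := fun P => by
      have := P.ofDual.isPrime
      exact PrimeSpectrum.ext (IsPrime.vanishingIdeal_zeroLocus P.ofDual.asIdeal)
    right_inv := fun Z => SetLike.coe_injective (zeros_vanishingIdeal L Z.isClosed)
    map_rel_iff' := fun {P Q} => zeros_subset_zeros_iff L P.ofDual.isPrime }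

variable {L} in
theorem codim_eq_height [IsAlgClosed L] {Z : IrreducibleCloseds (AffineSpace K L n)}
    {P : Ideal (MvPolynomial (Fin n) K)} (hP : P.IsPrime) (h : zeros L P = Z) :
    codim Z = P.height := by
  have h1 : Z = (irreducibleClosedsOrderIso L).symm (OrderDual.toDual ⟨P, hP⟩) :=
    SetLike.coe_injective h.symm
  rw [codim, h1, Order.coheight_orderIso, Order.coheight_toDual,
    ← PrimeSpectrum.height_eq_orderHeight]

theorem exists_isPrime_zeros_eq (Z : IrreducibleCloseds (AffineSpace K L n)) :
    ∃ P : Ideal (MvPolynomial (Fin n) K), P.IsPrime ∧ zeros L P = Z :=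
  ⟨_, isPrime_vanishingIdeal L Z.isIrreducible, zeros_vanishingIdeal L Z.isClosed⟩

variable {L} in
theorem isComponent_iff [IsAlgClosed L] {Z : IrreducibleCloseds (AffineSpace K L n)}
    {I P : Ideal (MvPolynomial (Fin n) K)} (hP : P.IsPrime) (h : zeros L P = Z) :
    IsComponent (zeros L I) Z ↔ P ∈ I.minimalPrimes := by
  constructor
  · rintro ⟨h1, h2⟩
    rw [← h, zeros_subset_zeros_iff L hP] at h1
    refine ⟨⟨hP, h1⟩, fun Q ⟨hQ, hIQ⟩ hQP => ?_⟩
    have h3 := h2 (y := ⟨zeros L Q, isIrreducible_zeros L hQ, isClosed_iff_exists_zeros.2 ⟨_, rfl⟩⟩)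
      (zeros_anti L hIQ) (show (Z : Set (AffineSpace K L n)) ⊆ zeros L Q from h ▸ zeros_anti L hQP)
    exact (zeros_subset_zeros_iff L hQ).1 (h ▸ h3)
  · rintro ⟨⟨-, h1⟩, h2⟩
    refine ⟨h.symm.trans_subset (zeros_anti L h1), fun W hW hZW => ?_⟩
    replace hW : (W : Set (AffineSpace K L n)) ⊆ zeros L I := hW
    obtain ⟨Q, hQ, hQW⟩ := exists_isPrime_zeros_eq L W
    rw [← hQW, zeros_subset_zeros_iff L hQ] at hW
    have h3 : (Z : Set (AffineSpace K L n)) ⊆ W := hZW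
    rw [← h, ← hQW, zeros_subset_zeros_iff L hP] at h3
    change (W : Set (AffineSpace K L n)) ⊆ Z
    rw [← h, ← hQW]
    exact zeros_anti L (h2 ⟨hQ, hW⟩ h3)

/-- The polynomials vanishing at `x` form a prime ideal; if it contains `I`, it contains a minimal
prime of `I`. -/
theorem mem_zeros_iff_exists_minimalPrimes {I : Ideal (MvPolynomial (Fin n) K)}
    {x : AffineSpace K L n} :
    x ∈ zeros L I ↔ ∃ P ∈ I.minimalPrimes, x ∈ zeros L P := by
  constructor
  · intro hx
    have hle : I ≤ RingHom.ker (aeval (R := K) (x : Fin n → L)) := fun p hp => hx p hp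
    have := RingHom.ker_isPrime (aeval (R := K) (x : Fin n → L))
    obtain ⟨P, hP, hPx⟩ := Ideal.exists_minimalPrimes_le hle
    exact ⟨P, hP, fun p hp => hPx hp⟩
  · rintro ⟨P, hP, hx⟩
    exact zeros_anti L hP.1.2 hx

theorem mem_nondegenerateLocus_iff [IsAlgClosed L] {c : ℕ}
    {f : Fin c → MvPolynomial (Fin n) K} {x : AffineSpace K L n} :
    x ∈ nondegenerateLocus L f ↔
      ∃ P ∈ (Ideal.span (Set.range f)).minimalPrimes, P.height = c ∧ x ∈ zeros L P := by
  simp only [nondegenerateLocus, Set.mem_iUnion, Set.mem_ofPred_eq, exists_prop]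
  constructor
  · rintro ⟨Z, ⟨hZ, hc⟩, hx⟩
    obtain ⟨P, hP, hPZ⟩ := exists_isPrime_zeros_eq L Z
    exact ⟨P, (isComponent_iff hP hPZ).1 hZ, codim_eq_height hP hPZ ▸ hc, hPZ ▸ hx⟩
  · rintro ⟨P, hP, hc, hx⟩
    have hPp : P.IsPrime := hP.1.1
    refine ⟨⟨zeros L P, isIrreducible_zeros L hPp, isClosed_iff_exists_zeros.2 ⟨_, rfl⟩⟩,
      ⟨(isComponent_iff hPp rfl).2 hP, ?_⟩, hx⟩
    rw [codim_eq_height hPp rfl, hc]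

end Geometry

end NondegenerateLocus

theorem mainTheorem2 {K L : Type*} [Field K] [Field L] [Algebra K L] [IsAlgClosure K L]
    {n c : ℕ} (hcn : c ≤ n) (f : Fin c → MvPolynomial (Fin n) K) :
    NondegenerateLocus.Terminates f ∧
      (∃ J : Ideal (MvPolynomial (Fin n) K), NondegenerateLocus.Outputs f J) ∧
      ∀ J : Ideal (MvPolynomial (Fin n) K), NondegenerateLocus.Outputs f J →
        NondegenerateLocus.zeros L J = NondegenerateLocus.nondegenerateLocus L f := by
  have : IsAlgClosed L := IsAlgClosure.isAlgClosed K
  refine ⟨NondegenerateLocus.terminates f, NondegenerateLocus.exists_outputs f, fun J hJ => ?_⟩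
  obtain ⟨𝒦, h⟩ := hJ.invariant
  ext x
  -- Both sides become unions of zero sets of primes, indexed by the same primes.
  rw [NondegenerateLocus.mem_zeros_iff_exists_minimalPrimes,
    NondegenerateLocus.mem_nondegenerateLocus_iff]
  simp only [h.mem_minimalPrimes_iff, and_assoc]
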